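/- Let $\mathbb K$ be a field and let $E=(E^0,E^1,r,s)$ be a directed graph (arbitrary sets of vertices and edges), with $s(e)$ and $r(e)$ the source and the range of an edge $e$. For vertices $a,b$ write $a\ge b$ if there is a path, possibly of length zero, from $a$ to $b$. Suppose that $E$ satisfies Condition (MT3): for all $a,b\in E^0$ there is $c\in E^0$ with $a\ge c$ and $b\ge c$. Suppose also that $v\in E^0$ is an infinite emitter (that is, $s^{-1}(v)$ is infinite) which is not the base of a cycle, where a cycle based at $v$ is a path $e_1\cdots e_n$ with $n\ge 1$, from $v$ to $v$, such that $s(e_1),\dots,s(e_n)$ are pairwise distinct. Let $L_{\mathbb K}(E)$ be the Leavitt path algebra of $E$: the (not necessarily unital) associative $\mathbb K$-algebra generated by $\{a,e,e^*: a\in E^0,\ e\in E^1\}$ subject to the relations $ab=\delta_{a,b}a$, $s(e)e=e=e\,r(e)$, $r(e)e^*=e^*=e^*s(e)$, $e^*f=\delta_{e,f}r(e)$ for $a,b\in E^0$ and $e,f\in E^1$, and $a=\sum_{s(e)=a}ee^*$ whenever $s^{-1}(a)$ is finite and nonempty. Then: 1. the center of the corner $vL_{\mathbb K}(E)v$ is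 $Z(vL_{\mathbb K}(E)v)=\mathbb K v$; 2. the centroid of $L_{\mathbb K}(E)$, i.e. the $\mathbb K$-algebra (under composition) of all $\mathbb K$-linear maps $\tau\colon L_{\mathbb K}(E)\to L_{\mathbb K}(E)$ with $\tau(xy)=\tau(x)y=x\tau(y)$ for all $x,y$, is isomorphic to $\mathbb K$ as a $\mathbb K$-algebra. -/

import Mathlib

universe u w x y

/-- A directed graph with vertex set `V` and edge set `Ed`, given by its source and range maps. -/
structure DirectedGraph (V : Type u) (Ed : Type w) where
  /-- the source of an edge -/
  s : Ed → V
  /-- the range of an edge -/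
  r : Ed → V

namespace DirectedGraph

variable {V : Type u} {Ed : Type w} (E : DirectedGraph V Ed)

/-- `E.IsPath a p b`: the finite sequence of edges `p` is a path from `a` to `b`. The empty sequence
is the path of length zero at `a = b`. -/
def IsPath : V → List Ed → V → Prop
  | a, [], b => a = b
  | a, e :: p, b => E.s e = a ∧ IsPath (E.r e) p b

/-- `a ≥ b`: there is a (possibly trivial) path from `a` to `b`. -/
def Reaches (a b : V) : Prop := ∃ p : List Ed, E.IsPath a p b

/-- Condition (MT3), downward directedness: any two vertices reach a common vertex. -/
def MT3 : Prop := ∀ a b : V, ∃ c : V, E.Reaches a c ∧ E.Reaches b c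

/-- `p` is a cycle based at `a`: a nontrivial closed path from `a` to `a` whose edges have pairwise
distinct sources. -/
def IsCycleAt (a : V) (p : List Ed) : Prop :=
  p ≠ [] ∧ E.IsPath a p a ∧ (p.map E.s).Nodup

/-- `a` is the base of a cycle. -/
def IsBaseOfCycle (a : V) : Prop := ∃ p : List Ed, E.IsCycleAt a p

/-- `a` is an infinite emitter: it is the source of infinitely many edges. -/
def IsInfiniteEmitter (a : V) : Prop := {e : Ed | E.s e = a}.Infinite

end DirectedGraph

/-- The generators of a Leavitt path algebra: vertices, (real) edges and ghost edges. -/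
inductive LeavittGen (V : Type u) (Ed : Type w) : Type (max u w)
  | vertex (a : V) : LeavittGen V Ed
  | edge (e : Ed) : LeavittGen V Ed
  | ghost (e : Ed) : LeavittGen V Ed

/-- The free associative (non-unital) `K`-algebra on the generators: the semigroup algebra of the free
semigroup. -/
abbrev LeavittFree (K : Type x) [Field K] (V : Type u) (Ed : Type w) : Type (max u w x) :=
  MonoidAlgebra K (FreeSemigroup (LeavittGen V Ed))

namespace LeavittFree

variable (K : Type x) [Field K] {V : Type u} {Ed : Type w}

/-- A generator as an element of the free algebra. -/
noncomputable def gen (g : LeavittGen V Ed) : LeavittFree K V Ed :=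
  MonoidAlgebra.single (FreeSemigroup.of g) 1

/-- A vertex in the free algebra. -/
noncomputable abbrev vertex (a : V) : LeavittFree K V Ed := gen K (LeavittGen.vertex a)

/-- A real edge in the free algebra. -/
noncomputable abbrev edge (e : Ed) : LeavittFree K V Ed := gen K (LeavittGen.edge e)

/-- A ghost edge in the free algebra. -/
noncomputable abbrev ghost (e : Ed) : LeavittFree K V Ed := gen K (LeavittGen.ghost e)

end LeavittFree

open LeavittFree in
/-- The defining relations (V), (E1), (E2), (CK1), (CK2) of the Leavitt path algebra. -/
inductive LeavittRel (K : Type x) [Field K] {V : Type u} {Ed : Type w} (E : DirectedGraph V Ed) :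
    LeavittFree K V Ed → LeavittFree K V Ed → Prop
  | vertex_mul_self (a : V) : LeavittRel K E (vertex K a * vertex K a) (vertex K a)
  | vertex_mul_of_ne (a b : V) (h : a ≠ b) : LeavittRel K E (vertex K a * vertex K b) 0
  | source_mul_edge (e : Ed) : LeavittRel K E (vertex K (E.s e) * edge K e) (edge K e)
  | edge_mul_range (e : Ed) : LeavittRel K E (edge K e * vertex K (E.r e)) (edge K e)
  | range_mul_ghost (e : Ed) : LeavittRel K E (vertex K (E.r e) * ghost K e) (ghost K e)
  | ghost_mul_source (e : Ed) : LeavittRel K E (ghost K e * vertex K (E.s e)) (ghost K e)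
  | ghost_mul_self (e : Ed) : LeavittRel K E (ghost K e * edge K e) (vertex K (E.r e))
  | ghost_mul_of_ne (e f : Ed) (h : e ≠ f) : LeavittRel K E (ghost K e * edge K f) 0
  | vertex_eq_sum (a : V) (hne : {e : Ed | E.s e = a}.Nonempty)
      (hfin : {e : Ed | E.s e = a}.Finite) :
      LeavittRel K E (vertex K a) (∑ e ∈ hfin.toFinset, edge K e * ghost K e)

/-- The smallest `K`-algebra congruence on the free algebra containing the defining relations. (For a
ring without unit, compatibility with scalars has to be built in: the ring congruence is generated by
all scalar multiples of the relations.) -/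
noncomputable def leavittCon (K : Type x) [Field K] {V : Type u} {Ed : Type w} (E : DirectedGraph V Ed) :
    RingCon (LeavittFree K V Ed) :=
  ringConGen fun p q => ∃ (k : K) (p' q' : LeavittFree K V Ed),
    LeavittRel K E p' q' ∧ p = k • p' ∧ q = k • q'

theorem leavittCon_smul (K : Type x) [Field K] {V : Type u} {Ed : Type w} (E : DirectedGraph V Ed)
    (k : K) {p q : LeavittFree K V Ed} (h : leavittCon K E p q) :
    leavittCon K E (k • p) (k • q) := by
  change RingConGen.Rel _ p q at h
  change RingConGen.Rel _ (k • p) (k • q)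
  induction h with
  | of p q h =>
    obtain ⟨l, p', q', h, rfl, rfl⟩ := h
    exact .of _ _ ⟨k * l, p', q', h, by rw [mul_smul], by rw [mul_smul]⟩
  | refl p => exact .refl _
  | symm _ ih => exact .symm ih
  | trans _ _ ih₁ ih₂ => exact .trans ih₁ ih₂
  | add _ _ ih₁ ih₂ => rw [smul_add, smul_add]; exact .add ih₁ ih₂
  | mul _ h₂ ih₁ _ => rw [← smul_mul_assoc, ← smul_mul_assoc]; exact .mul ih₁ h₂

/-- The Leavitt path algebra `L_K(E)` of a directed graph `E` over a field `K`. -/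
def LeavittPathAlgebra (K : Type x) [Field K] {V : Type u} {Ed : Type w} (E : DirectedGraph V Ed) :
    Type (max u w x) :=
  (leavittCon K E).Quotient

namespace LeavittPathAlgebra

variable (K : Type x) [Field K] {V : Type u} {Ed : Type w} (E : DirectedGraph V Ed)

noncomputable instance : NonUnitalRing (LeavittPathAlgebra K E) :=
  inferInstanceAs (NonUnitalRing (leavittCon K E).Quotient)

/-- The class of an element of the free algebra. -/
noncomputable def mk (p : LeavittFree K V Ed) : LeavittPathAlgebra K E := (p : (leavittCon K E).Quotient)

theorem mk_surjective : Function.Surjective (mk K E) := Quotient.mk''_surjective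

noncomputable instance : SMul K (LeavittPathAlgebra K E) where
  smul k := Quotient.map' (k • ·) fun _ _ h => leavittCon_smul K E k h

theorem mk_smul (k : K) (p : LeavittFree K V Ed) : mk K E (k • p) = k • mk K E p := rfl

theorem mk_mul (p q : LeavittFree K V Ed) : mk K E (p * q) = mk K E p * mk K E q := rfl

/-- The quotient map as an additive homomorphism. -/
noncomputable def mkAddHom : LeavittFree K V Ed →+ LeavittPathAlgebra K E where
  toFun := mk K E
  map_zero' := rfl
  map_add' _ _ := rfl

noncomputable instance : Module K (LeavittPathAlgebra K E) :=
  Function.Surjective.module K (mkAddHom K E) (mk_surjective K E) (mk_smul K E)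

instance : IsScalarTower K (LeavittPathAlgebra K E) (LeavittPathAlgebra K E) where
  smul_assoc k a b := by
    obtain ⟨p, rfl⟩ := mk_surjective K E a
    obtain ⟨q, rfl⟩ := mk_surjective K E b
    simp only [smul_eq_mul, ← mk_smul, ← mk_mul, smul_mul_assoc]

instance : SMulCommClass K (LeavittPathAlgebra K E) (LeavittPathAlgebra K E) where
  smul_comm k a b := by
    obtain ⟨p, rfl⟩ := mk_surjective K E a
    obtain ⟨q, rfl⟩ := mk_surjective K E b
    simp only [smul_eq_mul, ← mk_smul, ← mk_mul, mul_smul_comm]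

/-- The vertex `a` as an element of `L_K(E)`. -/
noncomputable def vertex (a : V) : LeavittPathAlgebra K E := mk K E (LeavittFree.vertex K a)

end LeavittPathAlgebra

section Algebras

variable (K : Type x) [Field K] (A : Type y) [NonUnitalRing A] [Module K A]

/-- The centroid of a (not necessarily unital) `K`-algebra `A`: the `K`-algebra, under composition, of
all `K`-linear maps `τ : A → A` with `τ (a b) = τ(a) b = a τ(b)`. -/
def algebraCentroid [IsScalarTower K A A] [SMulCommClass K A A] :
    Subalgebra K (Module.End K A) where
  carrier := {τ | ∀ a b : A, τ (a * b) = τ a * b ∧ τ (a * b) = a * τ b}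
  mul_mem' {σ τ} hσ hτ a b := by
    constructor
    · rw [Module.End.mul_apply, (hτ a b).1, (hσ _ _).1, Module.End.mul_apply]
    · rw [Module.End.mul_apply, (hτ a b).2, (hσ _ _).2, Module.End.mul_apply]
  add_mem' {σ τ} hσ hτ a b := by
    constructor
    · rw [LinearMap.add_apply, (hσ a b).1, (hτ a b).1, LinearMap.add_apply, add_mul]
    · rw [LinearMap.add_apply, (hσ a b).2, (hτ a b).2, LinearMap.add_apply, mul_add]
  algebraMap_mem' k a b := by
    simp only [Module.algebraMap_end_apply, smul_mul_assoc, mul_smul_comm, and_self]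

variable {A}

/-- The corner `e A e = {e a e : a ∈ A}`, as a subalgebra of `A`. -/
def cornerSubalgebra [IsScalarTower K A A] [SMulCommClass K A A] (e : A) :
    NonUnitalSubalgebra K A where
  carrier := {z | ∃ a : A, z = e * a * e}
  zero_mem' := ⟨0, by simp⟩
  add_mem' := by
    rintro _ _ ⟨a, rfl⟩ ⟨b, rfl⟩
    exact ⟨a + b, by simp only [mul_add, add_mul]⟩
  mul_mem' := by
    rintro _ _ ⟨a, rfl⟩ ⟨b, rfl⟩
    exact ⟨a * e * e * b, by simp only [mul_assoc]⟩
  smul_mem' := by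
    rintro k _ ⟨a, rfl⟩
    exact ⟨k • a, by simp only [mul_smul_comm, smul_mul_assoc]⟩

/-- The center `Z(e A e)` of the corner `e A e`, viewed as a subspace of `A`. -/
def cornerCenter [IsScalarTower K A A] [SMulCommClass K A A] (e : A) : Submodule K A :=
  ((NonUnitalSubalgebra.center K (cornerSubalgebra K e)).map
    (NonUnitalSubalgebraClass.subtype (cornerSubalgebra K e))).toSubmodule

end Algebras

/-! Expand a central `z` of `v L v` in monomials `p q*`. Since no cycle is based at `v`, the only
monomial at `v` with `p` trivial is `v` itself; every other one starts with an edge. As `v` emits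
infinitely many edges, some `f` from `v` avoids all these initial edges, so `f*` kills `w = z - k v`
for some scalar `k` (`exists_smul_ghost`). Centrality turns `f* w = 0` into `w y f* = 0`, hence `w y
r(f) = 0`, for all `y`. By (MT3) nothing nonzero annihilates a left ideal `L u` with `u` a vertex
(`eq_zero_of_mul_mul_vertex`): such an element kills an extension of every path, and induction on
ghost length (`eq_zero_of_forall_exists_mul_realPath`) reduces to combinations of real paths. For
these a graded representation on a branching system gives linear independence
(`eq_zero_of_mul_realPath_eq_zero`). So `w = 0`. For the centroid, `τ(v)` is central in `v L v`,
hence equals `k v`; then `τ - k` takes values annihilating `L v`, so it vanishes. -/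

namespace LeavittPathAlgebra

/-! ### Monomials `p q*` and the filtration by ghost length. -/

section Paths

variable (K : Type x) [Field K] {V : Type u} {Ed : Type w} (E : DirectedGraph V Ed)

/-- The edge `e` as an element of `L_K(E)`. -/
noncomputable def edge (e : Ed) : LeavittPathAlgebra K E := mk K E (LeavittFree.edge K e)

/-- The ghost edge `e*` as an element of `L_K(E)`. -/
noncomputable def ghost (e : Ed) : LeavittPathAlgebra K E := mk K E (LeavittFree.ghost K e)

variable {K E} in
theorem mk_eq_of_rel {p q : LeavittFree K V Ed} (h : LeavittRel K E p q) :
    mk K E p = mk K E q :=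
  (RingCon.eq _).2 (RingConGen.Rel.of _ _ ⟨1, p, q, h, (one_smul _ _).symm, (one_smul _ _).symm⟩)

theorem vertex_mul_self (a : V) : vertex K E a * vertex K E a = vertex K E a :=
  mk_eq_of_rel (.vertex_mul_self a)

theorem vertex_mul_of_ne {a b : V} (h : a ≠ b) : vertex K E a * vertex K E b = 0 :=
  mk_eq_of_rel (.vertex_mul_of_ne a b h)

theorem source_mul_edge (e : Ed) : vertex K E (E.s e) * edge K E e = edge K E e :=
  mk_eq_of_rel (.source_mul_edge e)

theorem edge_mul_range (e : Ed) : edge K E e * vertex K E (E.r e) = edge K E e :=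
  mk_eq_of_rel (.edge_mul_range e)

theorem range_mul_ghost (e : Ed) : vertex K E (E.r e) * ghost K E e = ghost K E e :=
  mk_eq_of_rel (.range_mul_ghost e)

theorem ghost_mul_source (e : Ed) : ghost K E e * vertex K E (E.s e) = ghost K E e :=
  mk_eq_of_rel (.ghost_mul_source e)

theorem ghost_mul_edge_self (e : Ed) : ghost K E e * edge K E e = vertex K E (E.r e) :=
  mk_eq_of_rel (.ghost_mul_self e)

theorem ghost_mul_edge_of_ne {e f : Ed} (h : e ≠ f) : ghost K E e * edge K E f = 0 :=
  mk_eq_of_rel (.ghost_mul_of_ne e f h)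

theorem vertex_eq_sum (a : V) (hne : {e : Ed | E.s e = a}.Nonempty)
    (hfin : {e : Ed | E.s e = a}.Finite) :
    vertex K E a = ∑ e ∈ hfin.toFinset, edge K E e * ghost K E e :=
  (mk_eq_of_rel (.vertex_eq_sum a hne hfin)).trans (map_sum (mkAddHom K E) _ _)

theorem edge_mul_vertex_of_ne {e : Ed} {a : V} (h : E.r e ≠ a) :
    edge K E e * vertex K E a = 0 := by
  rw [← edge_mul_range, mul_assoc, vertex_mul_of_ne K E h, mul_zero]

theorem vertex_mul_edge_of_ne {e : Ed} {a : V} (h : a ≠ E.s e) :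
    vertex K E a * edge K E e = 0 := by
  rw [← source_mul_edge, ← mul_assoc, vertex_mul_of_ne K E h, zero_mul]

theorem ghost_mul_vertex_of_ne {e : Ed} {a : V} (h : E.s e ≠ a) :
    ghost K E e * vertex K E a = 0 := by
  rw [← ghost_mul_source, mul_assoc, vertex_mul_of_ne K E h, mul_zero]

/-- The element of `L_K(E)` given by a path `p` starting at `b`. -/
noncomputable def realPath : V → List Ed → LeavittPathAlgebra K E
  | b, [] => vertex K E b
  | _, e :: p => edge K E e * realPath (E.r e) p

/-- The element `p*` of `L_K(E)` given by a path `p` starting at `b`. -/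
noncomputable def ghostPath : V → List Ed → LeavittPathAlgebra K E
  | b, [] => vertex K E b
  | _, e :: p => ghostPath (E.r e) p * ghost K E e

variable {K E}

theorem vertex_mul_realPath {b c : V} {p : List Ed} (h : E.IsPath b p c) :
    vertex K E b * realPath K E b p = realPath K E b p := by
  cases p with
  | nil => exact vertex_mul_self K E b
  | cons e p =>
    obtain ⟨rfl, -⟩ := h
    rw [realPath, ← mul_assoc, source_mul_edge]

theorem vertex_mul_realPath_of_ne {a b c : V} {p : List Ed} (h : E.IsPath b p c) (hab : a ≠ b) :
    vertex K E a * realPath K E b p = 0 := by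
  rw [← vertex_mul_realPath h, ← mul_assoc, vertex_mul_of_ne K E hab, zero_mul]

theorem edge_mul_realPath_of_ne {e : Ed} {b c : V} {p : List Ed} (h : E.IsPath b p c)
    (hb : E.r e ≠ b) : edge K E e * realPath K E b p = 0 := by
  rw [← vertex_mul_realPath h, ← mul_assoc, edge_mul_vertex_of_ne K E hb, zero_mul]

theorem realPath_mul_vertex {b c : V} {p : List Ed} (h : E.IsPath b p c) :
    realPath K E b p * vertex K E c = realPath K E b p := by
  induction p generalizing b with
  | nil => obtain rfl := h; exact vertex_mul_self K E _
  | cons e p ih => rw [realPath, mul_assoc, ih h.2]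

theorem ghostPath_mul_vertex {b c : V} {p : List Ed} (h : E.IsPath b p c) :
    ghostPath K E b p * vertex K E b = ghostPath K E b p := by
  cases p with
  | nil => exact vertex_mul_self K E b
  | cons e p =>
    obtain ⟨rfl, -⟩ := h
    rw [ghostPath, mul_assoc, ghost_mul_source]

theorem ghostPath_mul_vertex_of_ne {a b c : V} {p : List Ed} (h : E.IsPath b p c) (hab : b ≠ a) :
    ghostPath K E b p * vertex K E a = 0 := by
  rw [← ghostPath_mul_vertex h, mul_assoc, vertex_mul_of_ne K E hab, mul_zero]

theorem ghostPath_mul_realPath {b c : V} {p : List Ed} (h : E.IsPath b p c) :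
    ghostPath K E b p * realPath K E b p = vertex K E c := by
  induction p generalizing b with
  | nil => obtain rfl := h; exact vertex_mul_self K E _
  | cons e p ih =>
    rw [ghostPath, realPath, mul_assoc, ← mul_assoc (ghost K E e), ghost_mul_edge_self,
      vertex_mul_realPath h.2, ih h.2]

theorem _root_.DirectedGraph.IsPath.append {a b c : V} {p q : List Ed} (hp : E.IsPath a p b)
    (hq : E.IsPath b q c) : E.IsPath a (p ++ q) c := by
  induction p generalizing a with
  | nil => obtain rfl := hp; exact hq
  | cons e p ih => exact ⟨hp.1, ih hp.2⟩

theorem realPath_append {b c d : V} {p q : List Ed} (hp : E.IsPath b p c) (hq : E.IsPath c q d) :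
    realPath K E b (p ++ q) = realPath K E b p * realPath K E c q := by
  induction p generalizing b with
  | nil => obtain rfl := hp; exact (vertex_mul_realPath hq).symm
  | cons e p ih => rw [List.cons_append, realPath, realPath, ih hp.2, mul_assoc]

theorem ghostPath_append {b c d : V} {p q : List Ed} (hp : E.IsPath b p c) (hq : E.IsPath c q d) :
    ghostPath K E b (p ++ q) = ghostPath K E c q * ghostPath K E b p := by
  induction p generalizing b with
  | nil => obtain rfl := hp; exact (ghostPath_mul_vertex hq).symm
  | cons e p ih => rw [List.cons_append, ghostPath, ghostPath, ih hp.2, mul_assoc]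

theorem isPath_singleton (e : Ed) : E.IsPath (E.s e) [e] (E.r e) := ⟨rfl, rfl⟩

theorem realPath_singleton (e : Ed) : realPath K E (E.s e) [e] = edge K E e :=
  edge_mul_range K E e

theorem ghostPath_singleton (e : Ed) : ghostPath K E (E.s e) [e] = ghost K E e :=
  range_mul_ghost K E e

variable (K E)

/-- The span of the monomials `p q*` with `q` of length at most `n`. -/
noncomputable def ghostFiltration (n : ℕ) : Submodule K (LeavittPathAlgebra K E) :=
  Submodule.span K {z | ∃ (b c d : V) (p q : List Ed), E.IsPath b p c ∧ E.IsPath d q c ∧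
    q.length ≤ n ∧ z = realPath K E b p * ghostPath K E d q}

variable {K E}

theorem monomial_mem_ghostFiltration {b c d : V} {p q : List Ed} (hp : E.IsPath b p c)
    (hq : E.IsPath d q c) {n : ℕ} (hn : q.length ≤ n) :
    realPath K E b p * ghostPath K E d q ∈ ghostFiltration K E n :=
  Submodule.subset_span ⟨b, c, d, p, q, hp, hq, hn, rfl⟩

theorem ghostFiltration_mono : Monotone (ghostFiltration K E) := fun _ _ hmn =>
  Submodule.span_mono fun _ ⟨b, c, d, p, q, hp, hq, hl, hz⟩ =>
    ⟨b, c, d, p, q, hp, hq, hl.trans hmn, hz⟩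

/-- Only a ghost edge meeting a trivial `p` lengthens `q`, and by one; otherwise it cancels the
first edge of `p` or gives zero. This is the inductive step for words in the generators. -/
theorem mk_gen_mul_mem (g : LeavittGen V Ed) {n : ℕ} {z : LeavittPathAlgebra K E}
    (hz : z ∈ ghostFiltration K E n) :
    mk K E (LeavittFree.gen K g) * z ∈ ghostFiltration K E (n + 1) := by
  induction hz using Submodule.span_induction with
  | zero => rw [mul_zero]; exact zero_mem _
  | add _ _ _ _ h₁ h₂ => rw [mul_add]; exact add_mem h₁ h₂
  | smul k _ _ h => rw [mul_smul_comm]; exact Submodule.smul_mem _ k h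
  | mem z hz =>
    obtain ⟨b, c, d, p, q, hp, hq, hl, rfl⟩ := hz
    rw [← mul_assoc]
    cases g with
    | vertex a =>
      change vertex K E a * _ * _ ∈ _
      by_cases h : a = b
      · subst h
        rw [vertex_mul_realPath hp]
        exact monomial_mem_ghostFiltration hp hq (by omega)
      · rw [vertex_mul_realPath_of_ne hp h, zero_mul]; exact zero_mem _
    | edge e =>
      change edge K E e * _ * _ ∈ _
      by_cases h : E.r e = b
      · subst h
        exact monomial_mem_ghostFiltration (b := E.s e) (p := e :: p) ⟨rfl, hp⟩ hq (by omega)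
      · rw [edge_mul_realPath_of_ne hp h, zero_mul]; exact zero_mem _
    | ghost e =>
      change ghost K E e * _ * _ ∈ _
      cases p with
      | nil =>
        obtain rfl := hp
        rw [realPath]
        by_cases h : E.s e = b
        · subst h
          have := monomial_mem_ghostFiltration (K := K) (E := E) (b := E.r e) (p := []) rfl
            (hq.append (isPath_singleton e)) (n := n + 1) (by simpa using hl)
          rwa [ghostPath_append hq (isPath_singleton e), ghostPath_singleton, realPath,
            ← mul_assoc, range_mul_ghost, ← ghost_mul_source] at this
        · rw [ghost_mul_vertex_of_ne K E h, zero_mul]; exact zero_mem _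
      | cons f p =>
        rw [realPath, ← mul_assoc]
        by_cases h : e = f
        · subst h
          rw [ghost_mul_edge_self, vertex_mul_realPath hp.2]
          exact monomial_mem_ghostFiltration hp.2 hq (by omega)
        · rw [ghost_mul_edge_of_ne K E h, zero_mul, zero_mul]; exact zero_mem _

theorem mk_gen_mem (g : LeavittGen V Ed) :
    mk K E (LeavittFree.gen K g) ∈ ghostFiltration K E 1 := by
  cases g with
  | vertex a =>
    have := monomial_mem_ghostFiltration (K := K) (E := E) (b := a) (d := a) (p := []) (q := [])
      rfl rfl zero_le_one
    rwa [realPath, ghostPath, vertex_mul_self] at this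
  | edge e =>
    have := monomial_mem_ghostFiltration (K := K) (isPath_singleton (E := E) e)
      (d := E.r e) (q := []) rfl zero_le_one
    rwa [realPath_singleton, ghostPath, edge_mul_range] at this
  | ghost e =>
    have := monomial_mem_ghostFiltration (K := K) (b := E.r e) (p := []) rfl
      (isPath_singleton (E := E) e) le_rfl
    rwa [ghostPath_singleton, realPath, range_mul_ghost] at this

/-- The monomials `p q*` span `L_K(E)`. -/
theorem exists_mem_ghostFiltration (z : LeavittPathAlgebra K E) :
    ∃ n, z ∈ ghostFiltration K E n := by
  obtain ⟨z, rfl⟩ := mk_surjective K E z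
  induction z using MonoidAlgebra.induction_linear with
  | zero => exact ⟨0, zero_mem _⟩
  | add p q hp hq =>
    obtain ⟨m, hm⟩ := hp
    obtain ⟨n, hn⟩ := hq
    exact ⟨max m n, add_mem (ghostFiltration_mono (le_max_left m n) hm)
      (ghostFiltration_mono (le_max_right m n) hn)⟩
  | single g k =>
    have key : ∃ n, mk K E (MonoidAlgebra.single g 1) ∈ ghostFiltration K E n := by
      induction g using FreeSemigroup.recOnMul with
      | ih1 g => exact ⟨1, mk_gen_mem g⟩
      | ih2 g q _ hq =>
        obtain ⟨n, hn⟩ := hq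
        refine ⟨n + 1, ?_⟩
        have := mk_gen_mul_mem g hn
        rwa [← mk_mul, LeavittFree.gen, MonoidAlgebra.single_mul_single, one_mul] at this
    obtain ⟨n, hn⟩ := key
    refine ⟨n, ?_⟩
    have := Submodule.smul_mem _ k hn
    rwa [← mk_smul, MonoidAlgebra.smul_single, smul_eq_mul, mul_one] at this

end Paths

end LeavittPathAlgebra

/-! ### Universal property. -/

namespace LeavittPathAlgebra

section Lift

variable {K : Type x} [Field K] {V : Type u} {Ed : Type w} {E : DirectedGraph V Ed}

/-- The universal property of `L_K(E)`. -/
theorem exists_lift {A : Type*} [NonUnitalRing A] [Module K A] [IsScalarTower K A A]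
    [SMulCommClass K A A] (Fv : V → A) (Fe Fg : Ed → A)
    (hvv : ∀ a, Fv a * Fv a = Fv a) (hvw : ∀ a b, a ≠ b → Fv a * Fv b = 0)
    (hve : ∀ e, Fv (E.s e) * Fe e = Fe e) (hev : ∀ e, Fe e * Fv (E.r e) = Fe e)
    (hvg : ∀ e, Fv (E.r e) * Fg e = Fg e) (hgv : ∀ e, Fg e * Fv (E.s e) = Fg e)
    (hge : ∀ e, Fg e * Fe e = Fv (E.r e)) (hgf : ∀ e f, e ≠ f → Fg e * Fe f = 0)
    (hsum : ∀ a, {e : Ed | E.s e = a}.Nonempty → ∀ hfin : {e : Ed | E.s e = a}.Finite,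
      Fv a = ∑ e ∈ hfin.toFinset, Fe e * Fg e) :
    ∃ φ : LeavittPathAlgebra K E →ₙₐ[K] A,
      (∀ a, φ (vertex K E a) = Fv a) ∧ ∀ e, φ (edge K E e) = Fe e := by
  let f : LeavittGen V Ed → A := fun u => match u with
    | .vertex a => Fv a
    | .edge e => Fe e
    | .ghost e => Fg e
  let F : LeavittFree K V Ed →ₙₐ[K] A := MonoidAlgebra.liftMagma K (FreeSemigroup.lift f)
  have hF : ∀ u, F (LeavittFree.gen K u) = f u := fun u => by
    simp [F, LeavittFree.gen, MonoidAlgebra.liftMagma]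
  have h : ∀ p q, LeavittRel K E p q → F p = F q := by
    intro p q hpq
    cases hpq <;> simp only [map_sum, map_mul, map_zero, hF, f]
    · exact hvv _
    · exact hvw _ _ ‹_›
    · exact hve _
    · exact hev _
    · exact hvg _
    · exact hgv _
    · exact hge _
    · exact hgf _ _ ‹_›
    · exact hsum _ ‹_› _
  have hF' : ∀ p q, leavittCon K E p q → F p = F q := by
    intro p q hpq
    change RingConGen.Rel _ p q at hpq
    induction hpq with
    | of p q h' =>
      obtain ⟨l, p', q', h', rfl, rfl⟩ := h'
      rw [map_smul, map_smul, h _ _ h']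
    | refl p => rfl
    | symm _ ih => exact ih.symm
    | trans _ _ ih₁ ih₂ => exact ih₁.trans ih₂
    | add _ _ ih₁ ih₂ => rw [map_add, map_add, ih₁, ih₂]
    | mul _ _ ih₁ ih₂ => rw [map_mul, map_mul, ih₁, ih₂]
  let φ : LeavittPathAlgebra K E → A := fun z => Quotient.liftOn' z F hF'
  have hφ : ∀ p, φ (mk K E p) = F p := fun _ => rfl
  refine ⟨{ toFun := φ, map_smul' := ?_, map_zero' := ?_, map_add' := ?_, map_mul' := ?_ }, ?_, ?_⟩
  · intro k z
    obtain ⟨p, rfl⟩ := mk_surjective K E z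
    rw [← mk_smul, hφ, hφ, map_smul]
    rfl
  · exact (hφ 0).trans (map_zero F)
  · intro z z'
    obtain ⟨p, rfl⟩ := mk_surjective K E z
    obtain ⟨q, rfl⟩ := mk_surjective K E z'
    exact (hφ (p + q)).trans (map_add F p q)
  · intro z z'
    obtain ⟨p, rfl⟩ := mk_surjective K E z
    obtain ⟨q, rfl⟩ := mk_surjective K E z'
    exact (hφ (p * q)).trans (map_mul F p q)
  · exact fun a => hF (.vertex a)
  · exact fun e => hF (.edge e)

end Lift

end LeavittPathAlgebra

/-! ### Branching systems. -/

/-- Every graph has an algebraic branching system on `V × Y` in which the edge `e` acts as a bijection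
from `{r e} × Y` onto a subset of `{s e} × Y`. -/
theorem DirectedGraph.exists_branching {V : Type u} {Ed : Type w} (E : DirectedGraph V Ed) :
    ∃ g : Ed × (ℕ ⊕ Ed) → V × (ℕ ⊕ Ed), Function.Injective g ∧ (∀ z, (g z).1 = E.s z.1) ∧
      ∀ e y, ∃ z, g z = (E.s e, y) := by
  have key : ∀ a : V, ∃ h : {e // E.s e = a} × (ℕ ⊕ Ed) → ℕ ⊕ Ed, Function.Injective h ∧
      (Nonempty {e // E.s e = a} → Function.Surjective h) := by
    intro a
    by_cases ha : Nonempty {e // E.s e = a}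
    -- The fibre `ℕ ⊕ Ed` is infinite and at least as large as the set of edges leaving `a`, so the
    -- product of the two is again equinumerous with the fibre.
    · have hle : Cardinal.mk {e // E.s e = a} ≤ Cardinal.mk (ℕ ⊕ Ed) :=
        Cardinal.mk_le_of_injective (f := fun e => Sum.inr e.1)
          fun _ _ h => Subtype.ext (Sum.inr_injective h)
      have := Cardinal.mul_eq_right (Cardinal.aleph0_le_mk (ℕ ⊕ Ed)) hle
        (Cardinal.mk_ne_zero_iff.2 ha)
      rw [Cardinal.mul_def, Cardinal.eq] at this
      obtain ⟨h⟩ := this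
      exact ⟨h, h.injective, fun _ => h.surjective⟩
    · exact ⟨fun z => z.2, fun z => (ha ⟨z.1⟩).elim, fun h => (ha h).elim⟩
  choose h hinj hsurj using key
  have hcongr : ∀ (a : V) (e : Ed) (he : E.s e = a) (y : ℕ ⊕ Ed),
      h (E.s e) (⟨e, rfl⟩, y) = h a (⟨e, he⟩, y) := by
    rintro _ e rfl y
    rfl
  refine ⟨fun z => (E.s z.1, h (E.s z.1) (⟨z.1, rfl⟩, z.2)), ?_, fun _ => rfl, fun e y => ?_⟩
  · rintro ⟨e, y⟩ ⟨f, y'⟩ hz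
    obtain ⟨hs, hh⟩ := Prod.mk.inj hz
    rw [hcongr (E.s f) e hs y] at hh
    have := hinj _ hh
    simp only [Prod.mk.injEq, Subtype.mk.injEq] at this
    exact Prod.ext this.1 this.2
  · obtain ⟨⟨⟨f, hf⟩, y'⟩, hy⟩ := hsurj (E.s e) ⟨e, rfl⟩ y
    exact ⟨(f, y'), Prod.ext hf ((hcongr _ f hf y').trans hy)⟩

/-! ### Graded representation and independence of real paths. -/

namespace LeavittPathAlgebra

section Representation

variable (K : Type x) [Field K] {V : Type u} {Ed : Type w} (E : DirectedGraph V Ed)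

open Classical in
/-- The graded representation of `L_K(E)` attached to a branching system. -/
theorem exists_representation {Y : Type w} (g : Ed × Y → V × Y) (hinj : Function.Injective g)
    (hs : ∀ z, (g z).1 = E.s z.1) (hsurj : ∀ e y, ∃ z, g z = (E.s e, y)) :
    ∃ φ : LeavittPathAlgebra K E →ₙₐ[K] Module.End K ((V × Y) × ℤ →₀ K),
      (∀ a i, φ (vertex K E a) (Finsupp.single i 1) =
        if i.1.1 = a then Finsupp.single i 1 else 0) ∧
      ∀ e i, φ (edge K E e) (Finsupp.single i 1) =
        if i.1.1 = E.r e then Finsupp.single (g (e, i.1.2), i.2 + 1) 1 else 0 := by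
  -- A vertex projects onto its fibre, an edge acts through `g` and raises the `ℤ`-coordinate by
  -- one, and a ghost edge is the partial inverse; injectivity of `g` makes the chosen preimage
  -- unique.
  let Fv : V → Module.End K ((V × Y) × ℤ →₀ K) := fun a =>
    Finsupp.linearCombination K fun i => if i.1.1 = a then Finsupp.single i 1 else 0
  let Fe : Ed → Module.End K ((V × Y) × ℤ →₀ K) := fun e =>
    Finsupp.linearCombination K fun i =>
      if i.1.1 = E.r e then Finsupp.single (g (e, i.1.2), i.2 + 1) 1 else 0
  let Fg : Ed → Module.End K ((V × Y) × ℤ →₀ K) := fun e =>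
    Finsupp.linearCombination K fun i =>
      if h : ∃ y, g (e, y) = i.1 then Finsupp.single ((E.r e, h.choose), i.2 - 1) 1 else 0
  have hFv : ∀ a i, Fv a (Finsupp.single i 1) = if i.1.1 = a then Finsupp.single i 1 else 0 :=
    fun a i => by simp [Fv]
  have hFe : ∀ e i, Fe e (Finsupp.single i 1) =
      if i.1.1 = E.r e then Finsupp.single (g (e, i.1.2), i.2 + 1) 1 else 0 :=
    fun e i => by simp [Fe]
  have hFg₀ : ∀ e (i : (V × Y) × ℤ), (¬ ∃ y, g (e, y) = i.1) → Fg e (Finsupp.single i 1) = 0 :=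
    fun e i h => by simp [Fg, h]
  have hFg₁ : ∀ e y n, Fg e (Finsupp.single (g (e, y), n) 1) =
      Finsupp.single ((E.r e, y), n - 1) 1 := by
    intro e y n
    have h : ∃ y', g (e, y') = g (e, y) := ⟨y, rfl⟩
    have hc : h.choose = y := (Prod.mk.inj (hinj h.choose_spec)).2
    simp only [Fg, Finsupp.linearCombination_single, one_smul]
    rw [dif_pos h, hc]
  have hFg₂ : ∀ e f y n, e ≠ f → Fg e (Finsupp.single (g (f, y), n) 1) = 0 := by
    intro e f y n hef
    refine hFg₀ _ _ ?_
    rintro ⟨y', hy'⟩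
    exact hef (Prod.mk.inj (hinj hy')).1
  have hsrc : ∀ e y, (g (e, y)).1 = E.s e := fun e y => hs (e, y)
  have hext : ∀ {A B : Module.End K ((V × Y) × ℤ →₀ K)},
      (∀ i, A (Finsupp.single i 1) = B (Finsupp.single i 1)) → A = B := fun h =>
    Finsupp.lhom_ext' fun i => LinearMap.ext_ring (h i)
  obtain ⟨φ, hφv, hφe⟩ : ∃ φ : LeavittPathAlgebra K E →ₙₐ[K] Module.End K ((V × Y) × ℤ →₀ K),
      (∀ a, φ (vertex K E a) = Fv a) ∧ ∀ e, φ (edge K E e) = Fe e := by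
    refine exists_lift Fv Fe Fg ?_ ?_ ?_ ?_ ?_ ?_ ?_ ?_ ?_
    · intro a
      refine hext fun i => ?_
      change Fv a (Fv a _) = Fv a _
      rw [hFv]
      split_ifs with h
      · rw [hFv, if_pos h]
      · rw [map_zero]
    · intro a b h
      refine hext fun i => ?_
      change Fv a (Fv b _) = 0
      rw [hFv]
      split_ifs with h'
      · rw [hFv, if_neg fun h'' => h (h''.symm.trans h')]
      · rw [map_zero]
    · intro e
      refine hext fun i => ?_
      change Fv _ (Fe e _) = Fe e _
      rw [hFe]
      split_ifs with h
      · rw [hFv, if_pos (hsrc _ _)]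
      · rw [map_zero]
    · intro e
      refine hext fun i => ?_
      change Fe e (Fv _ _) = Fe e _
      rw [hFv, hFe]
      split_ifs with h
      · rw [hFe, if_pos h]
      · rw [map_zero]
    · intro e
      refine hext fun i => ?_
      change Fv _ (Fg e _) = Fg e _
      by_cases h : ∃ y, g (e, y) = i.1
      · obtain ⟨y, hy⟩ := h
        obtain ⟨j, n⟩ := i
        obtain rfl : _ = j := hy
        rw [hFg₁, hFv, if_pos rfl]
      · rw [hFg₀ _ _ h, map_zero]
    · intro e
      refine hext fun i => ?_
      change Fg e (Fv _ _) = Fg e _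
      rw [hFv]
      split_ifs with h
      · rfl
      · rw [map_zero, hFg₀]
        rintro ⟨y, hy⟩
        exact h (hy ▸ hsrc e y)
    · intro e
      refine hext fun i => ?_
      change Fg e (Fe e _) = Fv _ _
      rw [hFe, hFv]
      split_ifs with h
      · rw [hFg₁, add_sub_cancel_right, ← h]
      · rw [map_zero]
    · intro e e' h
      refine hext fun i => ?_
      change Fg e (Fe e' _) = 0
      rw [hFe]
      split_ifs
      · exact hFg₂ _ _ _ _ h
      · rw [map_zero]
    · intro a hne hfin
      refine hext fun i => ?_
      rw [LinearMap.sum_apply]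
      change Fv a _ = ∑ e ∈ hfin.toFinset, Fe e (Fg e _)
      rw [hFv]
      split_ifs with h
      · obtain ⟨e, he : E.s e = a⟩ := hne
        obtain ⟨⟨b, y⟩, n⟩ := i
        obtain rfl : b = a := h
        -- Relation (CK2): a basis vector over an emitting vertex lies in the image of exactly one
        -- edge, so one summand survives.
        obtain ⟨⟨e', y'⟩, hz⟩ := hsurj e y
        rw [he] at hz
        have he' : E.s e' = b := by rw [← hsrc e' y', hz]
        rw [Finset.sum_eq_single e', ← hz, hFg₁, hFe, if_pos rfl, sub_add_cancel]
        · intro e'' _ hne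
          rw [← hz, hFg₂ _ _ _ _ hne, map_zero]
        · exact fun h => (h (by simpa using he')).elim
      · symm
        refine Finset.sum_eq_zero fun e he => ?_
        have he : E.s e = a := by simpa using he
        rw [hFg₀, map_zero]
        rintro ⟨y, hy⟩
        exact h (by rw [← he, ← hsrc e y, hy])
  exact ⟨φ, fun a i => by rw [hφv, hFv], fun e i => by rw [hφe, hFe]⟩

/-- A linear combination of real paths ending at `a` that is killed on the right by a path starting
at `a` vanishes. -/
theorem eq_zero_of_mul_realPath_eq_zero {a c : V} {z : LeavittPathAlgebra K E}
    (hz : z ∈ Submodule.span K {z | ∃ b p, E.IsPath b p a ∧ z = realPath K E b p})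
    {β : List Ed} (hβ : E.IsPath a β c) (h : z * realPath K E a β = 0) : z = 0 := by
  obtain ⟨g, hinj, hs, hsurj⟩ := E.exists_branching
  obtain ⟨φ, hv, he⟩ := exists_representation K E g hinj hs hsurj
  let y₀ : ℕ ⊕ Ed := Sum.inl 0
  let act : List Ed → V × (ℕ ⊕ Ed) → V × (ℕ ⊕ Ed) := fun p j => p.foldr (fun e j => g (e, j.2)) j
  have hact : ∀ {b d : V} (p : List Ed), E.IsPath b p d → ∀ y, (act p (d, y)).1 = b := by
    intro b d p hp y
    cases p with
    | nil => exact hp.symm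
    | cons e p => exact (hs _).trans hp.1
  have hφ : ∀ {b d : V} (p : List Ed), E.IsPath b p d → ∀ y n,
      φ (realPath K E b p) (Finsupp.single ((d, y), n) 1) =
        Finsupp.single (act p (d, y), n + p.length) 1 := by
    intro b d p hp y n
    induction p generalizing b with
    | nil =>
      obtain rfl := hp
      simp [realPath, hv, act]
    | cons e p ih =>
      rw [realPath, map_mul, Module.End.mul_apply, ih hp.2, he, if_pos (hact p hp.2 y)]
      simp [act, add_assoc]
  -- Equal lengths are essential: a closed path may fix a point of the branching system. The
  -- `ℤ`-coordinate will supply this equality.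
  have hactinj : ∀ {b b' d : V} (p q : List Ed), E.IsPath b p d → E.IsPath b' q d →
      p.length = q.length → ∀ y, act p (d, y) = act q (d, y) → b = b' ∧ p = q := by
    intro b b' d p
    induction p generalizing b b' with
    | nil =>
      intro q hp hq hl y hy
      obtain rfl : q = [] := List.length_eq_zero_iff.1 hl.symm
      exact ⟨Eq.trans hp hq.symm, rfl⟩
    | cons e p ih =>
      intro q hp hq hl y hy
      cases q with
      | nil => simp at hl
      | cons f q =>
        obtain ⟨rfl, hp⟩ := hp
        obtain ⟨rfl, hq⟩ := hq
        have hg := hinj hy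
        obtain ⟨rfl, hg₂⟩ := Prod.mk.inj hg
        obtain ⟨-, rfl⟩ := ih q hp hq (by simpa using hl) y
          (Prod.ext ((hact p hp y).trans (hact q hq y).symm) hg₂)
        exact ⟨rfl, rfl⟩
  -- `β` sends a basis vector to the one at `j`, so `z β = 0` makes `z` kill that vector, on which
  -- distinct paths ending at `a` take distinct basis vectors as values.
  set j := act β (c, y₀) with hj
  have hja : j = (a, j.2) := Prod.ext (hact β hβ y₀) rfl
  have hzj : φ z (Finsupp.single ((a, j.2), (β.length : ℤ)) 1) = 0 := by
    have := congrArg (fun u => φ u (Finsupp.single ((c, y₀), 0) 1)) h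
    simpa only [map_mul, Module.End.mul_apply, hφ β hβ, map_zero, LinearMap.zero_apply, zero_add,
      ← hj, ← hja] using this
  let I := {i : V × List Ed // E.IsPath i.1 i.2 a}
  let ev : LeavittPathAlgebra K E →ₗ[K] ((V × (ℕ ⊕ Ed)) × ℤ →₀ K) :=
    (LinearMap.applyₗ (Finsupp.single ((a, j.2), (β.length : ℤ)) 1)) ∘ₗ
      (φ : LeavittPathAlgebra K E →ₗ[K] Module.End K ((V × (ℕ ⊕ Ed)) × ℤ →₀ K))
  have hset : {z | ∃ b p, E.IsPath b p a ∧ z = realPath K E b p} =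
      Set.range fun i : I => realPath K E i.1.1 i.1.2 := by
    ext u
    constructor
    · rintro ⟨b, p, hp, rfl⟩
      exact ⟨⟨(b, p), hp⟩, rfl⟩
    · rintro ⟨⟨⟨b, p⟩, hp⟩, rfl⟩
      exact ⟨b, p, hp, rfl⟩
  rw [hset, Finsupp.mem_span_range_iff_exists_finsupp] at hz
  obtain ⟨k, rfl⟩ := hz
  have hev : ∀ i : I, ev (realPath K E i.1.1 i.1.2) =
      Finsupp.single (act i.1.2 (a, j.2), (β.length : ℤ) + i.1.2.length) 1 := fun i =>
    hφ _ i.2 _ _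
  have hli : LinearIndependent K fun i : I => ev (realPath K E i.1.1 i.1.2) := by
    simp only [hev]
    refine (Finsupp.linearIndependent_single_one K ((V × (ℕ ⊕ Ed)) × ℤ)).comp
      (fun i : I => (act i.1.2 (a, j.2), (β.length : ℤ) + i.1.2.length)) ?_
    rintro ⟨⟨b, p⟩, hp⟩ ⟨⟨b', q⟩, hq⟩ hpq
    obtain ⟨hpq, hl⟩ := Prod.mk.inj hpq
    obtain ⟨rfl, rfl⟩ := hactinj p q hp hq (by simpa using hl) _ hpq
    rfl
  have hk : k = 0 := by
    refine linearIndependent_iff.1 hli k ?_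
    have : ev (k.sum fun i r => r • realPath K E i.1.1 i.1.2) = 0 := hzj
    simpa [Finsupp.linearCombination_apply, map_finsuppSum] using this
  simp [hk]

end Representation

end LeavittPathAlgebra

/-! ### Shortening closed paths to cycles. -/

namespace DirectedGraph.IsPath

variable {V : Type u} {Ed : Type w} {E : DirectedGraph V Ed}

theorem of_append_cons {a b : V} {p q : List Ed} {f : Ed} (h : E.IsPath a (p ++ f :: q) b) :
    E.IsPath (E.s f) (f :: q) b := by
  induction p generalizing a with
  | nil => exact ⟨rfl, h.2⟩
  | cons e p ih => exact ih h.2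

/-- A nontrivial path can be shortened to a nontrivial path with pairwise distinct sources. -/
theorem exists_nodup {a b : V} {p : List Ed} (h : E.IsPath a p b) :
    ∃ q, E.IsPath a q b ∧ (q.map E.s).Nodup ∧ (p ≠ [] → q ≠ []) := by
  induction p generalizing a with
  | nil => exact ⟨[], h, List.nodup_nil, id⟩
  | cons e p ih =>
    obtain ⟨hs, hp⟩ := h
    obtain ⟨q, hq, hnd, -⟩ := ih hp
    by_cases he : E.s e ∈ q.map E.s
    · obtain ⟨f, hf, hfe⟩ := List.mem_map.1 he
      obtain ⟨l, m, rfl⟩ := List.append_of_mem hf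
      refine ⟨f :: m, ?_, ?_, fun _ => List.cons_ne_nil _ _⟩
      · rw [← hs, ← hfe]
        exact hq.of_append_cons
      · rw [List.map_append] at hnd
        exact hnd.of_append_right
    · exact ⟨e :: q, ⟨hs, hq⟩, List.nodup_cons.2 ⟨he, hnd⟩, fun _ => List.cons_ne_nil _ _⟩

theorem eq_nil_of_not_isBaseOfCycle {v : V} (hc : ¬ E.IsBaseOfCycle v) {p : List Ed}
    (hp : E.IsPath v p v) : p = [] := by
  by_contra hne
  obtain ⟨q, hq, hnd, hq'⟩ := hp.exists_nodup
  exact hc ⟨q, hq' hne, hq, hnd⟩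

end DirectedGraph.IsPath

/-! ### Annihilators and central elements of the corner. -/

namespace LeavittPathAlgebra

section Center

variable {K : Type x} [Field K] {V : Type u} {Ed : Type w} {E : DirectedGraph V Ed}

theorem vertex_ne_zero (a : V) : vertex K E a ≠ 0 := by
  obtain ⟨g, hinj, hs, hsurj⟩ := E.exists_branching
  obtain ⟨φ, hv, -⟩ := exists_representation K E g hinj hs hsurj
  intro h
  have := hv a ((a, Sum.inl 0), 0)
  rw [h, map_zero, if_pos rfl, LinearMap.zero_apply] at this
  exact one_ne_zero (Finsupp.single_eq_zero.1 this.symm)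

theorem mul_vertex_mem_span_realPath {z : LeavittPathAlgebra K E}
    (hz : z ∈ ghostFiltration K E 0) (a : V) :
    z * vertex K E a ∈ Submodule.span K {z | ∃ b p, E.IsPath b p a ∧ z = realPath K E b p} := by
  induction hz using Submodule.span_induction with
  | zero => rw [zero_mul]; exact zero_mem _
  | add _ _ _ _ h₁ h₂ => rw [add_mul]; exact add_mem h₁ h₂
  | smul k _ _ h => rw [smul_mul_assoc]; exact Submodule.smul_mem _ k h
  | mem z hz =>
    obtain ⟨b, c, d, p, q, hp, hq, hl, rfl⟩ := hz
    obtain rfl : q = [] := by simpa using hl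
    obtain rfl := hq
    rw [ghostPath, realPath_mul_vertex hp]
    by_cases h : d = a
    · subst h
      rw [realPath_mul_vertex hp]
      exact Submodule.subset_span ⟨b, p, hp, rfl⟩
    · rw [← realPath_mul_vertex hp, mul_assoc, vertex_mul_of_ne K E h, mul_zero]
      exact zero_mem _

/-- The edge `f` cancels the rightmost ghost factor or gives zero; if `q` is trivial, it can only
extend `p`. This lowers the degree in the induction below. -/
theorem mul_edge_mem_ghostFiltration {n : ℕ} {z : LeavittPathAlgebra K E}
    (hz : z ∈ ghostFiltration K E (n + 1)) (f : Ed) : z * edge K E f ∈ ghostFiltration K E n := by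
  induction hz using Submodule.span_induction with
  | zero => rw [zero_mul]; exact zero_mem _
  | add _ _ _ _ h₁ h₂ => rw [add_mul]; exact add_mem h₁ h₂
  | smul k _ _ h => rw [smul_mul_assoc]; exact Submodule.smul_mem _ k h
  | mem z hz =>
    obtain ⟨b, c, d, p, q, hp, hq, hl, rfl⟩ := hz
    rw [mul_assoc]
    cases q with
    | nil =>
      obtain rfl := hq
      rw [ghostPath]
      by_cases h : d = E.s f
      · subst h
        have := monomial_mem_ghostFiltration (K := K) (hp.append (isPath_singleton f))
          (d := E.r f) (q := []) rfl (Nat.zero_le n)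
        rwa [realPath_append hp (isPath_singleton f), realPath_singleton, ghostPath, mul_assoc,
          edge_mul_range, ← source_mul_edge] at this
      · rw [vertex_mul_edge_of_ne K E h, mul_zero]; exact zero_mem _
    | cons e q =>
      rw [ghostPath, mul_assoc]
      by_cases h : e = f
      · subst h
        rw [ghost_mul_edge_self, ghostPath_mul_vertex hq.2]
        exact monomial_mem_ghostFiltration hp hq.2 (by simpa using hl)
      · rw [ghost_mul_edge_of_ne K E h, mul_zero, mul_zero]; exact zero_mem _

/-- Splitting off the last ghost edge. -/
theorem exists_eq_add_sum_mul_ghost (z : LeavittPathAlgebra K E) :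
    ∃ z₀ ∈ ghostFiltration K E 0, ∃ g : Ed →₀ LeavittPathAlgebra K E,
      z = z₀ + g.sum fun e y => y * ghost K E e := by
  classical
  obtain ⟨n, hz⟩ := exists_mem_ghostFiltration z
  induction hz using Submodule.span_induction with
  | zero => exact ⟨0, zero_mem _, 0, by simp⟩
  | add _ _ _ _ h₁ h₂ =>
    obtain ⟨y₁, hy₁, g₁, rfl⟩ := h₁
    obtain ⟨y₂, hy₂, g₂, rfl⟩ := h₂
    refine ⟨y₁ + y₂, add_mem hy₁ hy₂, g₁ + g₂, ?_⟩
    rw [Finsupp.sum_add_index' (fun _ => zero_mul _) (fun _ _ _ => add_mul _ _ _)]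
    abel
  | smul k _ _ h =>
    obtain ⟨y, hy, g, rfl⟩ := h
    refine ⟨k • y, Submodule.smul_mem _ k hy, k • g, ?_⟩
    rw [Finsupp.sum_smul_index' fun _ => zero_mul _, smul_add, Finsupp.smul_sum]
    simp only [smul_mul_assoc]
  | mem z hz =>
    obtain ⟨b, c, d, p, q, hp, hq, -, rfl⟩ := hz
    cases q with
    | nil => exact ⟨_, monomial_mem_ghostFiltration hp hq le_rfl, 0, by simp⟩
    | cons e q =>
      refine ⟨0, zero_mem _,
        Finsupp.single e (realPath K E b p * ghostPath K E (E.r e) q), ?_⟩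
      rw [Finsupp.sum_single_index (zero_mul _), ghostPath, zero_add, mul_assoc]

/-- An element that is killed on the right by an extension of every path vanishes. -/
theorem eq_zero_of_forall_exists_mul_realPath {a : V} {z : LeavittPathAlgebra K E}
    (ha : z * vertex K E a = z)
    (h : ∀ b p, E.IsPath a p b → ∃ c β, E.IsPath b β c ∧ z * realPath K E a (p ++ β) = 0) :
    z = 0 := by
  classical
  obtain ⟨n, hn⟩ := exists_mem_ghostFiltration z
  induction n generalizing a z with
  | zero =>
    obtain ⟨c, β, hβ, h⟩ := h a [] rfl
    exact eq_zero_of_mul_realPath_eq_zero K E (ha ▸ mul_vertex_mem_span_realPath hn a) hβ h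
  | succ n ih =>
    -- Paths from `r(f)` become paths from `a` when preceded by `f`, so the hypothesis passes to `z
    -- f`, whose ghost length is smaller.
    have hedge : ∀ f, E.s f = a → z * edge K E f = 0 := by
      rintro f rfl
      refine ih (a := E.r f) (by rw [mul_assoc, edge_mul_range]) ?_
        (mul_edge_mem_ghostFiltration hn f)
      intro b p hp
      obtain ⟨c, β, hβ, hz⟩ := h b (f :: p) ⟨rfl, hp⟩
      exact ⟨c, β, hβ, by rwa [List.cons_append, realPath, ← mul_assoc] at hz⟩
    obtain ⟨z₀, hz₀, g, hg⟩ := exists_eq_add_sum_mul_ghost z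
    have hsum : ∀ y : LeavittPathAlgebra K E,
        (g.sum fun e y => y * ghost K E e) * y = ∑ e ∈ g.support, g e * (ghost K E e * y) := by
      intro y
      rw [Finsupp.sum, Finset.sum_mul]
      exact Finset.sum_congr rfl fun e _ => mul_assoc _ _ _
    have hz₀' : z₀ * vertex K E a ∈
        Submodule.span K {z | ∃ b p, E.IsPath b p a ∧ z = realPath K E b p} :=
      mul_vertex_mem_span_realPath hz₀ a
    by_cases hne : {e : Ed | E.s e = a}.Nonempty
    · by_cases hfin : {e : Ed | E.s e = a}.Finite
      · rw [← ha, vertex_eq_sum K E a hne hfin, Finset.mul_sum]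
        refine Finset.sum_eq_zero fun e he => ?_
        rw [← mul_assoc, hedge e (by simpa using he), zero_mul]
      -- At an infinite emitter some `f` kills the whole ghost part, so `z f = 0` gives `z₀ f = 0`,
      -- hence `z₀ a = 0`. Then each `z e = 0` isolates the coefficient of `e*`.
      · obtain ⟨f, hf : E.s f = a, hfg⟩ :=
          (Set.not_finite.1 hfin).exists_notMem_finset g.support
        have hz₀a : z₀ * vertex K E a = 0 := by
          refine eq_zero_of_mul_realPath_eq_zero K E hz₀' (β := [f]) ⟨hf, rfl⟩ ?_
          have := hedge f hf
          rw [hg, add_mul, hsum, Finset.sum_eq_zero, add_zero] at this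
          · subst hf
            rw [realPath_singleton, mul_assoc, source_mul_edge, this]
          · intro e he
            rw [ghost_mul_edge_of_ne K E (e := e) (f := f) (fun hef => hfg (by rwa [← hef])), mul_zero]
        rw [← ha, hg, add_mul, hz₀a, zero_add, hsum]
        refine Finset.sum_eq_zero fun e he => ?_
        by_cases hea : E.s e = a
        · have := hedge e hea
          rw [hg, add_mul, hsum, Finset.sum_eq_single e, ghost_mul_edge_self,
            ← source_mul_edge, hea, ← mul_assoc, hz₀a, zero_mul, zero_add] at this
          · rw [← hea, ghost_mul_source, ← range_mul_ghost, ← mul_assoc, this, zero_mul]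
          · intro e' _ hne
            rw [ghost_mul_edge_of_ne K E hne, mul_zero]
          · exact fun h => (h he).elim
        · rw [ghost_mul_vertex_of_ne K E hea, mul_zero]
    -- At a sink no ghost edge survives right multiplication by `a`, so `z` is a combination of real
    -- paths.
    · have hza : z = z₀ * vertex K E a := by
        conv_lhs => rw [← ha, hg, add_mul, hsum]
        rw [Finset.sum_eq_zero, add_zero]
        intro e _
        rw [ghost_mul_vertex_of_ne K E (fun h => hne ⟨e, h⟩), mul_zero]
      obtain ⟨c, β, hβ, h⟩ := h a [] rfl
      exact eq_zero_of_mul_realPath_eq_zero K E (hza ▸ hz₀') hβ h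

/-- Up to a scalar multiple of `v`, every element of `v L v` is killed on the left by all but
finitely many of the ghost edges `f*` with `s f = v`. -/
theorem exists_smul_ghost {v : V} (hc : ¬ E.IsBaseOfCycle v) (z : LeavittPathAlgebra K E) :
    ∃ (k : K) (S : Finset Ed), ∀ f ∉ S, E.s f = v →
      ghost K E f * (z * vertex K E v) = k • ghost K E f := by
  classical
  obtain ⟨n, hz⟩ := exists_mem_ghostFiltration z
  induction hz using Submodule.span_induction with
  | zero => exact ⟨0, ∅, fun f _ _ => by simp⟩
  | add _ _ _ _ h₁ h₂ =>
    obtain ⟨k₁, S₁, h₁⟩ := h₁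
    obtain ⟨k₂, S₂, h₂⟩ := h₂
    refine ⟨k₁ + k₂, S₁ ∪ S₂, fun f hf hs => ?_⟩
    rw [Finset.mem_union, not_or] at hf
    rw [add_mul, mul_add, h₁ f hf.1 hs, h₂ f hf.2 hs, add_smul]
  | smul l _ _ h =>
    obtain ⟨k, S, h⟩ := h
    exact ⟨l * k, S, fun f hf hs => by
      rw [smul_mul_assoc, mul_smul_comm, h f hf hs, mul_smul]⟩
  | mem z hz =>
    obtain ⟨b, c, d, p, q, hp, hq, -, rfl⟩ := hz
    cases p with
    | nil =>
      obtain rfl := hp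
      by_cases hb : b = v
      · subst hb
        by_cases hd : d = b
        · subst hd
          -- The only monomial contributing to the scalar: `q` is closed at `v`, hence trivial.
          obtain rfl := DirectedGraph.IsPath.eq_nil_of_not_isBaseOfCycle hc hq
          refine ⟨1, ∅, fun f _ hs => ?_⟩
          subst hs
          rw [realPath, ghostPath, vertex_mul_self, vertex_mul_self, ghost_mul_source, one_smul]
        · exact ⟨0, ∅, fun f _ _ => by
            rw [mul_assoc, ghostPath_mul_vertex_of_ne hq hd, mul_zero, mul_zero, zero_smul]⟩
      · refine ⟨0, ∅, fun f _ hs => ?_⟩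
        rw [realPath, ← mul_assoc, ← mul_assoc,
          ghost_mul_vertex_of_ne K E (fun h => hb (h.symm.trans hs)), zero_mul, zero_mul, zero_smul]
    | cons e p =>
      refine ⟨0, {e}, fun f hf hs => ?_⟩
      rw [Finset.mem_singleton] at hf
      rw [realPath, ← mul_assoc, ← mul_assoc, ← mul_assoc, ghost_mul_edge_of_ne K E hf]
      simp

/-- An element annihilating the left ideal generated by a vertex `v` to which the graph is directed
vanishes. -/
theorem eq_zero_of_mul_mul_vertex (hE : E.MT3) {v d : V} {z : LeavittPathAlgebra K E}
    (hd : z * vertex K E d = z) (h : ∀ y, z * (y * vertex K E v) = 0) : z = 0 := by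
  refine eq_zero_of_forall_exists_mul_realPath hd fun b p hp => ?_
  -- With `y = p β γ*`, the product `y v γ` equals `p β`, so `z` kills the extension of `p` by `β`.
  obtain ⟨c, ⟨β, hβ⟩, γ, hγ⟩ := hE b v
  refine ⟨c, β, hβ, ?_⟩
  have := congrArg (· * realPath K E v γ) (h (realPath K E d (p ++ β) * ghostPath K E v γ))
  simpa only [mul_assoc, ghostPath_mul_vertex hγ, vertex_mul_realPath hγ, ghostPath_mul_realPath hγ,
    realPath_mul_vertex (hp.append hβ), zero_mul] using this

/-- The central elements of `v L v` are the scalar multiples of `v`. -/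
theorem mem_span_vertex_of_commute (hE : E.MT3) {v : V} (hv : E.IsInfiniteEmitter v)
    (hc : ¬ E.IsBaseOfCycle v) {z : LeavittPathAlgebra K E}
    (hz₁ : vertex K E v * z = z) (hz₂ : z * vertex K E v = z)
    (hz : ∀ y, z * (vertex K E v * y * vertex K E v) = vertex K E v * y * vertex K E v * z) :
    ∃ k : K, z = k • vertex K E v := by
  obtain ⟨k, S, hS⟩ := exists_smul_ghost hc z
  obtain ⟨f, hf : E.s f = v, hfS⟩ := Set.Infinite.exists_notMem_finset hv S
  refine ⟨k, sub_eq_zero.1 ?_⟩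
  have hfz : ghost K E f * (z - k • vertex K E v) = 0 := by
    have := hS f hfS hf
    rw [hz₂] at this
    subst hf
    rw [mul_sub, this, mul_smul_comm, ghost_mul_source, sub_self]
  have hw : (z - k • vertex K E v) * vertex K E v = z - k • vertex K E v := by
    rw [sub_mul, hz₂, smul_mul_assoc, vertex_mul_self]
  have hw' : vertex K E v * (z - k • vertex K E v) = z - k • vertex K E v := by
    rw [mul_sub, hz₁, mul_smul_comm, vertex_mul_self]
  -- Write `r(f) = f* f`. The difference commutes with `v y f* v`, which moves it next to `f*`,
  -- where it dies.
  refine eq_zero_of_mul_mul_vertex hE (v := E.r f) hw fun y => ?_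
  have hcomm : (z - k • vertex K E v) * (vertex K E v * (y * ghost K E f) * vertex K E v) =
      vertex K E v * (y * ghost K E f) * vertex K E v * (z - k • vertex K E v) := by
    rw [sub_mul, mul_sub, hz]
    simp only [smul_mul_assoc, mul_smul_comm, mul_assoc, vertex_mul_self]
    simp only [← mul_assoc, vertex_mul_self]
  have hzero : (z - k • vertex K E v) * (y * ghost K E f) = 0 := by
    have hfv : ghost K E f * vertex K E v = ghost K E f := by rw [← hf, ghost_mul_source]
    rw [mul_assoc (vertex K E v), mul_assoc y, hfv, ← mul_assoc, hw] at hcomm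
    rw [hcomm, mul_assoc, mul_assoc, hfz, mul_zero, mul_zero]
  rw [← ghost_mul_edge_self, ← mul_assoc y, ← mul_assoc, hzero, zero_mul]

end Center

end LeavittPathAlgebra

/-! ### The corner center and the centroid. -/

theorem mainTheorem8 {K : Type x} [Field K] {V : Type u} {Ed : Type w} (E : DirectedGraph V Ed)
    (hE : E.MT3) (v : V) (hv : E.IsInfiniteEmitter v) (hc : ¬ E.IsBaseOfCycle v) :
    cornerCenter K (LeavittPathAlgebra.vertex K E v) =
        Submodule.span K {LeavittPathAlgebra.vertex K E v} ∧
      Nonempty (algebraCentroid K (LeavittPathAlgebra K E) ≃ₐ[K] K) := by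
  open LeavittPathAlgebra in
  have hvv := vertex_mul_self K E v
  refine ⟨le_antisymm ?_ ?_, ?_⟩
  · rintro _ ⟨⟨z, a, rfl⟩, hz, rfl⟩
    obtain ⟨k, hk⟩ := mem_span_vertex_of_commute (K := K) hE hv hc
      (z := vertex K E v * a * vertex K E v)
      (by rw [← mul_assoc, ← mul_assoc, hvv]) (by rw [mul_assoc, hvv])
      (fun y => congrArg Subtype.val
        ((NonUnitalSubalgebra.mem_center_iff (R := K)).1 hz ⟨_, y, rfl⟩).symm)
    exact Submodule.mem_span_singleton.2 ⟨k, hk.symm⟩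
  · rw [Submodule.span_singleton_le_iff_mem]
    refine ⟨⟨vertex K E v, vertex K E v, by rw [hvv, hvv]⟩, ?_, rfl⟩
    refine (NonUnitalSubalgebra.mem_center_iff (R := K)).2 ?_
    rintro ⟨_, y, rfl⟩
    refine Subtype.ext ?_
    change vertex K E v * y * vertex K E v * vertex K E v =
      vertex K E v * (vertex K E v * y * vertex K E v)
    rw [mul_assoc, hvv, ← mul_assoc, ← mul_assoc, hvv]
  · refine ⟨(AlgEquiv.ofBijective (Algebra.ofId K (algebraCentroid K (LeavittPathAlgebra K E)))
      ⟨?_, ?_⟩).symm⟩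
    · refine (injective_iff_map_eq_zero _).2 fun k hk => ?_
      have : k • vertex K E v = 0 :=
        congrArg (fun τ : algebraCentroid K (LeavittPathAlgebra K E) =>
          (τ : Module.End K (LeavittPathAlgebra K E)) (vertex K E v)) hk
      exact (smul_eq_zero.1 this).resolve_right (vertex_ne_zero v)
    · rintro ⟨τ, hτ⟩
      have hl : ∀ a b, τ (a * b) = τ a * b := fun a b => (hτ a b).1
      have hr : ∀ a b, τ (a * b) = a * τ b := fun a b => (hτ a b).2
      -- For `u` in `v L v`, both `τ(v) u` and `u τ(v)` equal `τ(u)`.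
      obtain ⟨k, hk⟩ := mem_span_vertex_of_commute (K := K) hE hv hc
        (z := τ (vertex K E v)) (by rw [← hr, hvv]) (by rw [← hl, hvv]) (fun y => by
          rw [← hl, ← hr]
          simp only [← mul_assoc, hvv]
          simp only [mul_assoc, hvv])
      refine ⟨k, Subtype.ext (LinearMap.ext fun z => ?_)⟩
      change k • z = τ z
      -- Monomials suffice by linearity, and each has a single vertex `d` as right unit, as the
      -- annihilator lemma requires.
      obtain ⟨n, hn⟩ := exists_mem_ghostFiltration z
      induction hn using Submodule.span_induction with
      | zero => simp
      | add _ _ _ _ h₁ h₂ => rw [smul_add, map_add, h₁, h₂]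
      | smul l _ _ h => rw [map_smul, ← h, smul_comm]
      | mem z hz =>
        obtain ⟨b, c, d, p, q, hp, hq, -, rfl⟩ := hz
        have hd : realPath K E b p * ghostPath K E d q * vertex K E d =
            realPath K E b p * ghostPath K E d q := by rw [mul_assoc, ghostPath_mul_vertex hq]
        -- For a monomial `z`, `τ(z) y v = z y τ(v) = k z y v`, so `τ(z) - k z` annihilates `L v`.
        refine (sub_eq_zero.1 (eq_zero_of_mul_mul_vertex hE (v := v) (d := d) ?_ fun y => ?_)).symm
        · rw [sub_mul, ← hl, smul_mul_assoc, hd]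
        · rw [sub_mul, ← hl, hr, hr, hk]
          simp only [mul_smul_comm, smul_mul_assoc, sub_self]
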